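/- Let $S$ be a positive semifield, i.e. a semiring (multiplication not assumed commutative) such that $a+b=0$ implies $a=b=0$ and every $a\neq 0$ has a two-sided multiplicative inverse. Let $(\mathcal P,\eta^{\mathcal P},\mu^{\mathcal P})$ be the powerset monad on $\mathrm{Set}$ (direct images, singletons, unions), and let $(\mathcal S,\eta^{\mathcal S},\mu^{\mathcal S})$ be the semimodule monad: $\mathcal S X$ is the set of finitely supported functions $X\to S$, $\mathcal S(f)(\varphi)(y)=\sum_{f(x)=y}\varphi(x)$, $\eta^{\mathcal S}_X(x)=\Delta_x$ (value $1$ at $x$ and $0$ elsewhere) and $\mu^{\mathcal S}_X(\Psi)(x)=\sum_{\varphi\in\operatorname{supp}\Psi}\Psi(\varphi)\varphi(x)$. For a map $a:\mathcal S X\to X$ and $A\subseteq X$, the convex closure of $A$ is $\overline{A}^{a}=\{a(\varphi)\mid \varphi\in \mathcal S X,\ \operatorname{supp}\varphi\subseteq A,\ \sum_x\varphi(x)=1\}$; $A$ is $a$-convex if $A=\overline{A}^{a}$, and $\mathcal P_c^{a}X$ is the set of $a$-convex subsets of $X$. For $\Phi\in\mathcal S\mathcal P X$ let $c(\Phi)$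 be the set of all $\mathcal S(u)(\Phi|_{\operatorname{supp}\Phi})$, where $u:\operatorname{supp}\Phi\to X$ satisfies $u(A)\in A$ for all $A$. For $\Omega\in \mathcal S\mathcal P_c^{a}X$, regarded as an element of $\mathcal S\mathcal P X$, let $\alpha_a(\Omega)=\{a(\varphi)\mid\varphi\in c(\Omega)\}$. For monads $T,R$ on a category, a weak distributive law $\delta:TR\to RT$ is a natural transformation satisfying the axioms of a distributive law of $R$ over $T$ except the one involving $\eta^T$. A weak lifting of $R$ to the category $\mathrm{EM}(T)$ of $T$-algebras, with forgetful functor $U$, is a monad $\tilde R$ on $\mathrm{EM}(T)$ with natural transformations $\iota:U\tilde R\to RU$ and $\pi:RU\to U\tilde R$ such that $\pi\iota=\mathrm{id}$ and $\iota,\pi$ are compatible with the units and multiplications of $R$ and $\tilde R$. It is determined by $\delta$ if, for each $T$-algebra $(X,a)$, $\iota\pi=Ra\circ\delta_X\circ\eta^T_{RX}$ and the structure map of $\tilde R(X,a)$ is $\pi\circ Ra\circ\delta_X\circ T\iota$. The composite monad is then the monad of the composite adjunction between the base category, $\mathrm{EM}(T)$ and $\mathrm{EM}(\tilde R)$. **Theorem.**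 There is a weak distributive law $\delta:\mathcal S\mathcal P\to\mathcal P\mathcal S$ (the canonical one) such that, for all sets $X$ and $\Phi\in\mathcal S\mathcal P X$, $\delta_X(\Phi)$ is the set of all $\varphi\in\mathcal S X$ for which there is a finitely supported $\psi:\{(A,x)\in\mathcal P X\times X\mid x\in A\}\to S$ with $\Phi(A)=\sum_{x\in A}\psi(A,x)$ for all $A$ and $\varphi(x)=\sum_{A\ni x}\psi(A,x)$ for all $x$; equivalently, $\delta_X(\Phi)=\overline{c(\Phi)}^{\mu^{\mathcal S}_X}$. This $\delta$ determines a weak lifting of $\mathcal P$ to $\mathrm{EM}(\mathcal S)$ and thereby induces a monad $\mathcal P_c\mathcal S$ on $\mathrm{Set}$, whose functor, unit and multiplication are $$\mathcal P_c\mathcal S(X)=\mathcal P_c^{\mu^{\mathcal S}_X}(\mathcal S X),\qquad \mathcal P_c\mathcal S(f)(\mathcal A)=\{\mathcal S(f)(\Phi)\mid\Phi\in\mathcal A\},$$ $$\eta_X(x)=\{\Delta_x\},\qquad \mu_X(\mathscr A)=\bigcup_{\Omega\in\mathscr A}\alpha_{\mu^{\mathcal S}_X}(\Omega).$$ That is,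 these data form a well-defined monad, and for every weak lifting of $\mathcal P$ determined by $\delta$ the associated composite monad is isomorphic to it as a monad, by an isomorphism $e$ such that $\iota_{(\mathcal S X,\mu^{\mathcal S}_X)}\circ e_X$ is the inclusion $\mathcal P_c\mathcal S(X)\subseteq\mathcal P\mathcal S X$ for all sets $X$. -/

import Mathlib

open CategoryTheory

universe v u

noncomputable section

namespace CompositeMonad

/-! ### Weak distributive laws, weak liftings and composite monads on a category -/

section General

variable {C : Type u} [Category.{v} C]

/-- A weak distributive law `T S → S T` of the monad `S` over the monad `T`: the axioms of a
distributive law except the one on the unit of `T`. (Functors compose from left to right, so that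
`S.toFunctor ⋙ T.toFunctor` is `X ↦ T (S X)`.) -/
structure WeakDistributiveLaw (T S : Monad C) where
  law : S.toFunctor ⋙ T.toFunctor ⟶ T.toFunctor ⋙ S.toFunctor
  mul_outer : ∀ X : C,
    law.app (S.obj X) ≫ S.map (law.app X) ≫ S.μ.app (T.obj X) = T.map (S.μ.app X) ≫ law.app X
  mul_inner : ∀ X : C,
    T.map (law.app X) ≫ law.app (T.obj X) ≫ S.map (T.μ.app X) = T.μ.app (S.obj X) ≫ law.app X
  unit_outer : ∀ X : C, T.map (S.η.app X) ≫ law.app X = S.η.app (T.obj X)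

/-- A weak lifting of the monad `S` to the category of Eilenberg-Moore algebras of `T`. -/
structure WeakLifting (T S : Monad C) where
  monad : Monad T.Algebra
  ι : monad.toFunctor ⋙ T.forget ⟶ T.forget ⋙ S.toFunctor
  π : T.forget ⋙ S.toFunctor ⟶ monad.toFunctor ⋙ T.forget
  ι_π : ∀ A : T.Algebra, ι.app A ≫ π.app A = 𝟙 (monad.obj A).A
  ι_mul : ∀ A : T.Algebra,
    ι.app (monad.obj A) ≫ S.map (ι.app A) ≫ S.μ.app A.A = (monad.μ.app A).f ≫ ι.app A
  ι_unit : ∀ A : T.Algebra, (monad.η.app A).f ≫ ι.app A = S.η.app A.A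
  π_mul : ∀ A : T.Algebra,
    S.map (π.app A) ≫ π.app (monad.obj A) ≫ (monad.μ.app A).f = S.μ.app A.A ≫ π.app A
  π_unit : ∀ A : T.Algebra, S.η.app A.A ≫ π.app A = (monad.η.app A).f

/-- `W` is the weak lifting determined by the weak distributive law `δ`: for every `T`-algebra
`(X, a)`, the maps `π` and `ι` split the idempotent `S a ∘ δ ∘ η` on `S X`, and the structure map
of the lifted algebra is `π ∘ S a ∘ δ ∘ T ι`. (All other data of `W` are then forced by the
naturality of `ι` and by `ι_mul`, `ι_unit`, since `ι` is a split monomorphism.) -/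
def WeakLifting.IsDeterminedBy {T S : Monad C} (W : WeakLifting T S)
    (δ : WeakDistributiveLaw T S) : Prop :=
  ∀ A : T.Algebra,
    W.π.app A ≫ W.ι.app A = T.η.app (S.obj A.A) ≫ δ.law.app A.A ≫ S.map A.a ∧
    (W.monad.obj A).a = T.map (W.ι.app A) ≫ δ.law.app A.A ≫ S.map A.a ≫ W.π.app A

/-- The composite monad on `C` of a weak lifting: the monad of the composite of the two free-forgetful
adjunctions, between `C` and the algebras of `T`, and between the algebras of `T` and the
algebras (over those) of the lifted monad. -/
def WeakLifting.compositeMonad {T S : Monad C} (W : WeakLifting T S) : Monad C :=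
  (T.adj.comp W.monad.adj).toMonad

/-- A monad structure on a given endofunctor. -/
structure MonadStructure (F : C ⥤ C) where
  η : 𝟭 C ⟶ F
  μ : F ⋙ F ⟶ F
  assoc : ∀ X, F.map (μ.app X) ≫ μ.app X = μ.app (F.obj X) ≫ μ.app X
  left_unit : ∀ X, η.app (F.obj X) ≫ μ.app X = 𝟙 (F.obj X)
  right_unit : ∀ X, F.map (η.app X) ≫ μ.app X = 𝟙 (F.obj X)

/-- The monad with a given underlying endofunctor and monad structure. -/
def MonadStructure.toMonad {F : C ⥤ C} (M : MonadStructure F) : Monad C where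
  toFunctor := F
  η := M.η
  μ := M.μ
  assoc := M.assoc
  left_unit := M.left_unit
  right_unit := M.right_unit

end General

/-! ### The powerset monad and the semimodule monad -/

/-- The powerset monad on sets. -/
def powersetMonad : Monad (Type u) where
  obj X := Set X
  map f := ↾(fun A => f '' A)
  map_id X := by ext A x; simp
  map_comp f g := by ext A x; simp
  η := { app := fun X => ↾(fun x => ({x} : Set X))
         naturality := fun X Y f => by ext x y; simp }
  μ := { app := fun X => ↾(fun U : Set (Set X) => ⋃₀ U)
         naturality := fun X Y f => by
          ext U y
          simp [Set.mem_sUnion]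
          grind }
  assoc X := by
    ext U x
    simp [Set.mem_sUnion]
    grind
  left_unit X := by ext A x; simp
  right_unit X := by ext A x; simp

/-- A positive semifield: `a + b = 0` forces `a = b = 0`, and every non-zero element is invertible.
(Multiplication is not assumed commutative.) -/
structure IsPositiveSemifield (S : Type u) [Semiring S] : Prop where
  positive : ∀ a b : S, a + b = 0 → a = 0 ∧ b = 0
  exists_inv : ∀ a : S, a ≠ 0 → ∃ x : S, a * x = 1 ∧ x * a = 1

variable (S : Type u) [Semiring S]

/-- The multiplication of the semimodule monad: `Ψ ↦ (x ↦ ∑ φ ∈ supp Ψ, Ψ φ * φ x)`. -/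
def semimoduleMul (X : Type u) (Ψ : (X →₀ S) →₀ S) : X →₀ S :=
  Ψ.sum fun φ s => s • φ

theorem semimoduleMul_single {X : Type u} (φ : X →₀ S) (s : S) :
    semimoduleMul S X (Finsupp.single φ s) = s • φ := by
  simp [semimoduleMul]

theorem semimoduleMul_add {X : Type u} (Ψ Ψ' : (X →₀ S) →₀ S) :
    semimoduleMul S X (Ψ + Ψ') = semimoduleMul S X Ψ + semimoduleMul S X Ψ' := by
  classical
  exact Finsupp.sum_add_index' (by simp) (by simp [add_smul])

theorem semimoduleMul_zero {X : Type u} : semimoduleMul S X 0 = 0 := by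
  simp [semimoduleMul]

theorem semimoduleMul_smul {X : Type u} (s : S) (Ψ : (X →₀ S) →₀ S) :
    semimoduleMul S X (s • Ψ) = s • semimoduleMul S X Ψ := by
  induction Ψ using Finsupp.induction_linear with
  | zero => simp [semimoduleMul_zero]
  | add f g hf hg => simp [semimoduleMul_add, hf, hg]
  | single a b => rw [Finsupp.smul_single, semimoduleMul_single, semimoduleMul_single,
      smul_eq_mul, mul_smul]

theorem semimoduleMul_mapDomain {X Y : Type u} (f : X → Y) (Ψ : (X →₀ S) →₀ S) :
    semimoduleMul S Y (Ψ.mapDomain (Finsupp.mapDomain f)) =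
      (semimoduleMul S X Ψ).mapDomain f := by
  induction Ψ using Finsupp.induction_linear with
  | zero => simp [semimoduleMul_zero]
  | add g h hg hh => simp [semimoduleMul_add, Finsupp.mapDomain_add, hg, hh]
  | single a b => simp [semimoduleMul_single, Finsupp.mapDomain_single, Finsupp.mapDomain_smul]

/-- The semimodule monad on sets: `X` goes to the finitely supported functions `X → S`, and `f` to
push-forward along `f`; the unit is `x ↦ Δ_x`. -/
def semimoduleMonad : Monad (Type u) where
  obj X := X →₀ S
  map f := ↾(Finsupp.mapDomain f)
  map_id X := by
    apply ConcreteCategory.hom_ext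
    intro φ
    exact Finsupp.mapDomain_id
  map_comp f g := by
    apply ConcreteCategory.hom_ext
    intro φ
    exact Finsupp.mapDomain_comp (f := f) (g := g)
  η := { app := fun X => ↾(fun x => Finsupp.single x (1 : S))
         naturality := fun X Y f => by ext x; simp [Finsupp.mapDomain_single] }
  μ := { app := fun X => ↾(semimoduleMul S X)
         naturality := fun X Y f => by ext Ψ; simp [semimoduleMul_mapDomain] }
  assoc X := by
    apply ConcreteCategory.hom_ext
    intro Θ
    change semimoduleMul S X (Finsupp.mapDomain (semimoduleMul S X) Θ) =
      semimoduleMul S X (semimoduleMul S (X →₀ S) Θ)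
    induction Θ using Finsupp.induction_linear with
    | zero => simp [semimoduleMul_zero]
    | add g h hg hh => simp [semimoduleMul_add, Finsupp.mapDomain_add, hg, hh]
    | single a b => simp [semimoduleMul_single, Finsupp.mapDomain_single, semimoduleMul_smul]
  left_unit X := by ext φ; simp [semimoduleMul_single]
  right_unit X := by
    apply ConcreteCategory.hom_ext
    intro φ
    change semimoduleMul S X (Finsupp.mapDomain (fun x => Finsupp.single x (1 : S)) φ) = φ
    induction φ using Finsupp.induction_linear with
    | zero => simp [semimoduleMul_zero]
    | add g h hg hh => simp [semimoduleMul_add, Finsupp.mapDomain_add, hg, hh]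
    | single a b => simp [semimoduleMul_single, Finsupp.mapDomain_single]

variable {S}

/-! ### The canonical law, convex subsets, and the explicit data of the composite monad -/

/-- The value at `Φ` of the canonical law, which comes from the extension of the semimodule functor
to relations applied to `∋`: all `φ` for which some `ψ ∈ S(∋)` has
`Φ A = ∑ x ∈ A, ψ (A, x)` for all `A` and `φ x = ∑ A ∋ x, ψ (A, x)` for all `x`. -/
def canonicalLaw {X : Type u} (Φ : Set X →₀ S) : Set (X →₀ S) :=
  {φ | ∃ ψ : {p : Set X × X // p.2 ∈ p.1} →₀ S,
    Φ = ψ.mapDomain (fun p => p.1.1) ∧ φ = ψ.mapDomain (fun p => p.1.2)}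

/-- The set of all `S(u)(Φ)`, where `u` selects an element of each set in the support of `Φ`. -/
def choice {X : Type u} (Φ : Set X →₀ S) : Set (X →₀ S) :=
  {φ | ∃ u : {A : Set X // A ∈ Φ.support} → X, (∀ A, u A ∈ A.1) ∧
    φ = (Φ.subtypeDomain (· ∈ Φ.support)).mapDomain u}

/-- The convex closure of `A ⊆ X` with respect to `a : S X → X`. -/
def convexClosure {X : Type u} (a : (X →₀ S) → X) (A : Set X) : Set X :=
  {x | ∃ φ : X →₀ S, (φ.support : Set X) ⊆ A ∧ (φ.sum fun _ s => s) = 1 ∧ a φ = x}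

/-- The set of convex subsets of `X` with respect to `a : S X → X`. -/
def ConvexSubset {X : Type u} (a : (X →₀ S) → X) : Type u :=
  {A : Set X // A = convexClosure a A}

/-- `α_a(Φ) = {a φ | φ ∈ c(Φ)}` for a finitely supported family `Φ` of convex subsets. -/
def alpha {X : Type u} (a : (X →₀ S) → X) (Φ : ConvexSubset a →₀ S) : Set X :=
  a '' choice (Φ.mapDomain Subtype.val)

theorem image_convex {X Y : Type u} (f : X → Y) (A : Set (X →₀ S))
    (hA : A = convexClosure (semimoduleMul S X) A) :
    Finsupp.mapDomain f '' A =
      convexClosure (semimoduleMul S Y) (Finsupp.mapDomain f '' A) := by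
  classical
  apply Set.Subset.antisymm
  · intro y hy
    refine ⟨Finsupp.single y 1, ?_, by simp, by simp [semimoduleMul_single]⟩
    intro z hz
    have hz' := Finsupp.support_single_subset (Finset.mem_coe.1 hz)
    rw [Finset.mem_singleton.1 hz']
    exact hy
  · rintro y ⟨Ψ, hsupp, hsum, rfl⟩
    have hg : ∀ z : Y →₀ S, ∃ w : X →₀ S,
        z ∈ Finsupp.mapDomain f '' A → w ∈ A ∧ Finsupp.mapDomain f w = z := by
      intro z
      by_cases hz : z ∈ Finsupp.mapDomain f '' A
      · obtain ⟨w, hw, hwz⟩ := hz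
        exact ⟨w, fun _ => ⟨hw, hwz⟩⟩
      · exact ⟨0, fun h => absurd h hz⟩
    choose g hg using hg
    refine ⟨semimoduleMul S X (Ψ.mapDomain g), ?_, ?_⟩
    · rw [hA]
      refine ⟨Ψ.mapDomain g, ?_, ?_, rfl⟩
      · intro w hw
        obtain ⟨z, hz, rfl⟩ := Finset.mem_image.1 (Finsupp.mapDomain_support hw)
        exact (hg z (hsupp hz)).1
      · rw [Finsupp.sum_mapDomain_index (by simp) (by simp)]
        exact hsum
    · rw [← semimoduleMul_mapDomain, ← Finsupp.mapDomain_comp]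
      congr 1
      conv_rhs => rw [← Finsupp.mapDomain_id (v := Ψ)]
      exact Finsupp.mapDomain_congr fun z hz => (hg z (hsupp hz)).2

variable (S)

/-- The endofunctor of the composite monad: `X` goes to the set of convex subsets of the free
semimodule `S X`, and `f` to direct image under `S f`. -/
def convexPowerset : Type u ⥤ Type u where
  obj X := ConvexSubset (semimoduleMul S X)
  map f := ↾(fun A => ⟨Finsupp.mapDomain f '' A.1, image_convex f A.1 A.2⟩)
  map_id X := by
    apply ConcreteCategory.hom_ext
    intro A
    apply Subtype.ext
    change Finsupp.mapDomain id '' A.1 = A.1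
    rw [funext fun φ => Finsupp.mapDomain_id (v := φ), Set.image_id']
  map_comp f g := by
    apply ConcreteCategory.hom_ext
    intro A
    apply Subtype.ext
    change Finsupp.mapDomain (g ∘ f) '' A.1 = Finsupp.mapDomain g '' (Finsupp.mapDomain f '' A.1)
    rw [Set.image_image]
    exact Set.image_congr fun φ _ => Finsupp.mapDomain_comp

end CompositeMonad

end

namespace CompositeMonad

/-! ### Arithmetic in a positive semifield -/

section Couplings

variable {S : Type u} [Semiring S]

/-! The law is the extension of the semimodule functor to relations, applied to `∋`: `φ ∈ δ Φ` means
that some `ψ` supported on `∋` has marginals `Φ` and `φ` (`Coupled`). The extension respects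
composition because the functor preserves weak pullbacks (`exists_coupling`), and it is compatible
with `μ` because the naturality squares of `μ` are weak pullbacks (`exists_semimoduleMul_eq`). Both
fillers are built by dividing by masses of fibres, which positivity keeps nonzero. Naturality and
the axioms of the law then become identities between relations.

The theory of liftings is formal. The law turns each `R X` into a semialgebra, and acting on units
gives an idempotent; any choice of splittings carries a lifted monad. On free algebras the
idempotent, the unit and the multiplication are all expressed through the inclusion into `R (T X)`,
so composite monads of different liftings agree. For the canonical law the idempotent is convex
closure, split by the convex subsets; the explicit functor receives its monad structure by
transport, so no monad law has to be checked for it by hand.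

Two concrete facts remain. In `canonicalLaw_eq_convexClosure`, the normalised slices of a coupling
are made the marginals of one distribution on choice functions, which exhibits the coupling as a
mixture of choices. In `alpha_eq_image_canonicalLaw`, the sets are convex, so each normalised slice
evaluates to a point of its own set and a single choice suffices. -/

theorem IsPositiveSemifield.mul_eq_zero (hS : IsPositiveSemifield S) {a b : S} (h : a * b = 0) :
    a = 0 ∨ b = 0 := by
  by_cases ha : a = 0
  · exact Or.inl ha
  · obtain ⟨x, -, hx⟩ := hS.exists_inv a ha
    right
    rw [← one_mul b, ← hx, mul_assoc, h, mul_zero]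

theorem IsPositiveSemifield.sum_eq_zero (hS : IsPositiveSemifield S) {ι : Type*} {s : Finset ι}
    {f : ι → S} (h : ∑ i ∈ s, f i = 0) : ∀ i ∈ s, f i = 0 := by
  classical
  induction s using Finset.induction_on with
  | empty => simp
  | insert a s ha ih =>
    rw [Finset.sum_insert ha] at h
    obtain ⟨h1, h2⟩ := hS.positive _ _ h
    exact Finset.forall_mem_insert _ _ _ |>.2 ⟨h1, ih h2⟩

/-- By positivity no cancellation occurs within a fibre, so fibre masses over the support can be
inverted. -/
theorem IsPositiveSemifield.mapDomain_apply_ne_zero (hS : IsPositiveSemifield S) {X Y : Type*}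
    (f : X → Y) (φ : X →₀ S) {x : X} (hx : φ x ≠ 0) : φ.mapDomain f (f x) ≠ 0 := by
  classical
  intro h
  rw [Finsupp.mapDomain, Finsupp.sum_apply, Finsupp.sum] at h
  have := hS.sum_eq_zero h x (Finsupp.mem_support_iff.2 hx)
  simp at this
  exact hx this

/-- Neither cancellation nor zero divisors can remove a point from a mixture. Support conditions on
a mixture thus pass to its components. -/
theorem IsPositiveSemifield.support_subset_support_semimoduleMul (hS : IsPositiveSemifield S)
    {X : Type u} (Ψ : (X →₀ S) →₀ S) {φ : X →₀ S} (hφ : φ ∈ Ψ.support) :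
    φ.support ⊆ (semimoduleMul S X Ψ).support := by
  intro x hx
  rw [Finsupp.mem_support_iff] at *
  intro h
  rw [semimoduleMul, Finsupp.sum_apply, Finsupp.sum] at h
  have := hS.sum_eq_zero h φ (Finsupp.mem_support_iff.2 hφ)
  rcases hS.mul_eq_zero (by simpa using this) with h | h
  · exact hφ h
  · exact hx h

theorem mem_support_semimoduleMul {X : Type u} {Ψ : (X →₀ S) →₀ S} {x : X}
    (hx : x ∈ (semimoduleMul S X Ψ).support) : ∃ φ ∈ Ψ.support, x ∈ φ.support := by
  classical
  obtain ⟨φ, hφ, hx⟩ := Finset.mem_biUnion.1 (Finsupp.support_sum hx)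
  exact ⟨φ, hφ, Finsupp.support_smul hx⟩

theorem exists_mem_support_mapDomain {X Y : Type*} {f : X → Y} {φ : X →₀ S} {y : Y}
    (hy : y ∈ (φ.mapDomain f).support) : ∃ x ∈ φ.support, f x = y := by
  classical
  simpa using Finsupp.mapDomain_support hy

theorem mapDomain_apply_eq_sum {X Y : Type*} [DecidableEq Y] (f : X → Y) (φ : X →₀ S) (y : Y) :
    φ.mapDomain f y = φ.sum fun x r => if f x = y then r else 0 := by
  rw [Finsupp.mapDomain, Finsupp.sum_apply]
  exact Finsupp.sum_congr fun x _ => Finsupp.single_apply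

theorem mapDomain_val_subtypeDomain {X : Type*} (p : X → Prop) (φ : X →₀ S)
    (h : ∀ x ∈ φ.support, p x) : (φ.subtypeDomain p).mapDomain Subtype.val = φ := by
  ext x
  by_cases hx : p x
  · exact Finsupp.mapDomain_apply Subtype.val_injective _ (⟨x, hx⟩ : Subtype p)
  · rw [Finsupp.mapDomain_of_notMem_range _ _ (by simpa using hx)]
    exact (Finsupp.notMem_support_iff.1 fun h' => hx (h x h')).symm

/-! ### Weak pullbacks -/

/-- The semimodule functor of a positive semifield preserves weak pullbacks. -/
theorem IsPositiveSemifield.exists_coupling (hS : IsPositiveSemifield S) {A B Y : Type*}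
    (f : A → Y) (g : B → Y) (φ : A →₀ S) (χ : B →₀ S) (h : φ.mapDomain f = χ.mapDomain g) :
    ∃ ψ : A × B →₀ S, (∀ p ∈ ψ.support, p.1 ∈ φ.support ∧ p.2 ∈ χ.support ∧ f p.1 = g p.2) ∧
      ψ.mapDomain Prod.fst = φ ∧ ψ.mapDomain Prod.snd = χ := by
  classical
  choose! inv hinv using hS.exists_inv
  set s := φ.mapDomain f with hs
  -- Over each `y`, the product of the two fibre distributions divided by their common mass `s y`.
  -- The inverse stands in the middle so that it cancels from the right when summing over `b` and
  -- from the left when summing over `a`, without commutativity.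
  refine ⟨φ.sum fun a r => χ.sum fun b t =>
    if f a = g b then Finsupp.single (a, b) (r * inv (s (g b)) * t) else 0, ?_, ?_, ?_⟩
  · intro p hp
    obtain ⟨a, ha, hp⟩ := Finset.mem_biUnion.1 (Finsupp.support_sum hp)
    obtain ⟨b, hb, hp⟩ := Finset.mem_biUnion.1 (Finsupp.support_sum hp)
    split_ifs at hp with hab
    · obtain rfl := Finset.mem_singleton.1 (Finsupp.support_single_subset hp)
      exact ⟨ha, hb, hab⟩
    · simp at hp
  · simp only [Finsupp.sum, Finsupp.mapDomain_finsetSum]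
    conv_rhs => rw [← Finsupp.sum_single φ]
    refine Finset.sum_congr rfl fun a ha => ?_
    have hsa : s (f a) ≠ 0 :=
      hS.mapDomain_apply_ne_zero f φ (Finsupp.mem_support_iff.1 ha)
    calc _ = ∑ b ∈ χ.support, Finsupp.single a
          (φ a * inv (s (f a)) * (if g b = f a then χ b else 0)) := by
          refine Finset.sum_congr rfl fun b _ => ?_
          by_cases hab : f a = g b
          · simp [hab, Finsupp.mapDomain_single, -Finsupp.single_mul]
          · simp [hab, Ne.symm hab]
      _ = Finsupp.single a (φ a) := by
          rw [← Finsupp.single_finsetSum, ← Finset.mul_sum]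
          have : ∑ b ∈ χ.support, (if g b = f a then χ b else 0) = s (f a) := by
            rw [h, mapDomain_apply_eq_sum]; rfl
          rw [this, mul_assoc, (hinv _ hsa).2, mul_one]
  · simp only [Finsupp.sum, Finsupp.mapDomain_finsetSum]
    rw [Finset.sum_comm]
    conv_rhs => rw [← Finsupp.sum_single χ]
    refine Finset.sum_congr rfl fun b hb => ?_
    have hsb : s (g b) ≠ 0 := by
      rw [h]
      exact hS.mapDomain_apply_ne_zero g χ (Finsupp.mem_support_iff.1 hb)
    calc _ = ∑ a ∈ φ.support, Finsupp.single b
          ((if f a = g b then φ a else 0) * (inv (s (g b)) * χ b)) := by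
          refine Finset.sum_congr rfl fun a _ => ?_
          by_cases hab : f a = g b
          · simp [hab, Finsupp.mapDomain_single, mul_assoc, -Finsupp.single_mul]
          · simp [hab]
      _ = Finsupp.single b (χ b) := by
          rw [← Finsupp.single_finsetSum, ← Finset.sum_mul]
          have : ∑ a ∈ φ.support, (if f a = g b then φ a else 0) = s (g b) := by
            rw [hs, mapDomain_apply_eq_sum]; rfl
          rw [this, ← mul_assoc, (hinv _ hsb).1, one_mul]

/-- Left-linear maps are homomorphisms of free algebras. This is needed for maps that are not
push-forwards along a function. -/
theorem semimoduleMul_mapDomain_of_linear {X Y : Type u} (L : (X →₀ S) → (Y →₀ S))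
    (h0 : L 0 = 0) (hadd : ∀ a b, L (a + b) = L a + L b) (hsmul : ∀ (s : S) a, L (s • a) = s • L a)
    (Ψ : (X →₀ S) →₀ S) :
    semimoduleMul S Y (Ψ.mapDomain L) = L (semimoduleMul S X Ψ) := by
  induction Ψ using Finsupp.induction_linear with
  | zero => simp [semimoduleMul_zero, h0]
  | add g h hg hh => simp [semimoduleMul_add, Finsupp.mapDomain_add, hg, hh, hadd]
  | single a b => simp [semimoduleMul_single, Finsupp.mapDomain_single, hsmul]

/-- The naturality squares of the multiplication of the semimodule monad of a positive semifield
are weak pullbacks. -/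
theorem IsPositiveSemifield.exists_semimoduleMul_eq (hS : IsPositiveSemifield S) {X Y : Type u}
    (f : X → Y) (φ : X →₀ S) (Ψ : (Y →₀ S) →₀ S) (h : semimoduleMul S Y Ψ = φ.mapDomain f) :
    ∃ Ψ' : (X →₀ S) →₀ S, semimoduleMul S X Ψ' = φ ∧
      Ψ'.mapDomain (Finsupp.mapDomain f) = Ψ := by
  classical
  choose! inv hinv using hS.exists_inv
  set s := φ.mapDomain f with hs
  -- `L` spreads the mass of `χ` at `y` over the fibre of `y` in the proportions given by `φ`.
  -- Scalars of `χ` stay on the left, so `L` is left-linear; it sends `s` to `φ`, and it is a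
  -- section of the push-forward on every `χ` supported in the support of `s`.
  let L : (Y →₀ S) → (X →₀ S) := fun χ =>
    φ.sum fun x r => Finsupp.single x (χ (f x) * inv (s (f x)) * r)
  have hL : semimoduleMul S X (Ψ.mapDomain L) = L (semimoduleMul S Y Ψ) := by
    refine semimoduleMul_mapDomain_of_linear L ?_ ?_ ?_ Ψ
    · simp [L]
    · intro a b
      simp [L, Finsupp.sum, ← Finset.sum_add_distrib, ← Finsupp.single_add, add_mul,
        -Finsupp.single_mul]
    · intro t a
      simp [L, Finsupp.sum, Finset.smul_sum, mul_assoc, -Finsupp.single_mul]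
  refine ⟨Ψ.mapDomain L, ?_, ?_⟩
  · rw [hL, h]
    conv_rhs => rw [← Finsupp.sum_single φ]
    refine Finset.sum_congr rfl fun x hx => ?_
    have hsx : s (f x) ≠ 0 :=
      hS.mapDomain_apply_ne_zero f φ (Finsupp.mem_support_iff.1 hx)
    simp only
    rw [(hinv _ hsx).1, one_mul]
  · rw [← Finsupp.mapDomain_comp]
    conv_rhs => rw [← Finsupp.mapDomain_id (v := Ψ)]
    refine Finsupp.mapDomain_congr fun χ hχ => ?_
    ext y
    have hsy : s y = ∑ x ∈ φ.support, if f x = y then φ x else 0 := by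
      rw [hs, mapDomain_apply_eq_sum]; rfl
    have hy : (L χ).mapDomain f y =
        χ y * inv (s y) * ∑ x ∈ φ.support, if f x = y then φ x else 0 := by
      simp only [L, Finsupp.sum, Finsupp.mapDomain_finsetSum, Finsupp.mapDomain_single,
        Finsupp.finsetSum_apply]
      rw [Finset.mul_sum]
      refine Finset.sum_congr rfl fun x _ => ?_
      by_cases hxy : f x = y
      · simp [hxy, -Finsupp.single_mul]
      · simp [hxy]
    change (L χ).mapDomain f y = χ y
    rw [hy, ← hsy]
    by_cases hχy : χ y = 0
    · simp [hχy]
    · have := hS.support_subset_support_semimoduleMul Ψ hχ (Finsupp.mem_support_iff.2 hχy)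
      rw [h, Finsupp.mem_support_iff] at this
      rw [mul_assoc, (hinv _ this).2, mul_one]

/-! ### The extension of the semimodule functor to relations -/

/-- The extension of the semimodule functor to relations. -/
def Coupled {X Y : Type*} (R : X → Y → Prop) (φ : X →₀ S) (χ : Y →₀ S) : Prop :=
  ∃ ψ : X × Y →₀ S, (∀ p ∈ ψ.support, R p.1 p.2) ∧
    ψ.mapDomain Prod.fst = φ ∧ ψ.mapDomain Prod.snd = χ

theorem Coupled.of_span {X Y Z : Type*} {R : X → Y → Prop} (ψ : Z →₀ S) (f : Z → X) (g : Z → Y)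
    (h : ∀ z ∈ ψ.support, R (f z) (g z)) : Coupled R (ψ.mapDomain f) (ψ.mapDomain g) := by
  refine ⟨ψ.mapDomain fun z => (f z, g z), ?_, ?_, ?_⟩
  · intro p hp
    obtain ⟨z, hz, rfl⟩ := exists_mem_support_mapDomain hp
    exact h z hz
  · rw [← Finsupp.mapDomain_comp]; rfl
  · rw [← Finsupp.mapDomain_comp]; rfl

theorem coupled_graph {X Y : Type*} (f : X → Y) (φ : X →₀ S) (χ : Y →₀ S) :
    Coupled (fun x y => f x = y) φ χ ↔ φ.mapDomain f = χ := by
  constructor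
  · rintro ⟨ψ, h, rfl, rfl⟩
    rw [← Finsupp.mapDomain_comp]
    exact Finsupp.mapDomain_congr h
  · rintro rfl
    simpa using Coupled.of_span (R := fun x y => f x = y) φ id f (by simp)

/-- From right to left, two couplings with the same middle marginal are glued along it by
`exists_coupling`. -/
theorem coupled_comp (hS : IsPositiveSemifield S) {X Y Z : Type*} (R : X → Y → Prop)
    (Q : Y → Z → Prop) (φ : X →₀ S) (χ : Z →₀ S) :
    Coupled (fun x z => ∃ y, R x y ∧ Q y z) φ χ ↔ ∃ θ, Coupled R φ θ ∧ Coupled Q θ χ := by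
  constructor
  · rintro ⟨ψ, h, rfl, rfl⟩
    -- Extending the choice of middle points off the support needs a point of `Y`; if there is none,
    -- `ψ` has empty support.
    rcases isEmpty_or_nonempty Y with hY | hY
    · have : ψ = 0 := by
        rw [← Finsupp.support_eq_empty, Finset.eq_empty_iff_forall_notMem]
        intro p hp
        exact hY.elim (h p hp).choose
      subst this
      exact ⟨0, ⟨0, by simp⟩, ⟨0, by simp⟩⟩
    · choose! y hy using h
      exact ⟨ψ.mapDomain y, .of_span _ _ _ fun p hp => (hy p hp).1,
        .of_span _ _ _ fun p hp => (hy p hp).2⟩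
  · rintro ⟨θ, ⟨ψ, h, rfl, hθ⟩, ⟨ψ', h', hθ', rfl⟩⟩
    obtain ⟨ω, hω, rfl, rfl⟩ := hS.exists_coupling Prod.snd Prod.fst ψ ψ' (hθ.trans hθ'.symm)
    rw [← Finsupp.mapDomain_comp, ← Finsupp.mapDomain_comp]
    refine .of_span _ _ _ fun p hp => ⟨p.1.2, ?_, ?_⟩
    · exact h _ (hω p hp).1
    · rw [(hω p hp).2.2]
      exact h' _ (hω p hp).2.1

theorem coupled_graph_comp {W X Y : Type*} (f : W → X) (R : X → Y → Prop) (φ : W →₀ S)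
    (χ : Y →₀ S) (hS : IsPositiveSemifield S) :
    Coupled R (φ.mapDomain f) χ ↔ Coupled (fun w y => R (f w) y) φ χ := by
  have := coupled_comp hS (fun w x => f w = x) R φ χ
  simpa [coupled_graph] using this.symm

theorem coupled_comp_graph {X Y Z : Type*} (f : Y → Z) (R : X → Y → Prop) (φ : X →₀ S)
    (χ : Z →₀ S) (hS : IsPositiveSemifield S) :
    Coupled (fun x z => ∃ y, R x y ∧ f y = z) φ χ ↔ ∃ θ, Coupled R φ θ ∧ θ.mapDomain f = χ := by
  simpa [coupled_graph] using coupled_comp hS R (fun y z => f y = z) φ χ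

/-- Choose a coupling for each related pair and mix these couplings with the weights of the outer
one. -/
theorem Coupled.semimoduleMul {X Y : Type u} {R : X → Y → Prop} {Θ : (X →₀ S) →₀ S}
    {Ξ : (Y →₀ S) →₀ S} (h : Coupled (Coupled R) Θ Ξ) :
    Coupled R (semimoduleMul S X Θ) (semimoduleMul S Y Ξ) := by
  obtain ⟨ψ, h, rfl, rfl⟩ := h
  choose! w hw using h
  refine ⟨CompositeMonad.semimoduleMul S _ (ψ.mapDomain w), ?_, ?_, ?_⟩
  · intro p hp
    obtain ⟨ω, hω, hp⟩ := mem_support_semimoduleMul hp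
    obtain ⟨q, hq, rfl⟩ := exists_mem_support_mapDomain hω
    exact (hw q hq).1 p hp
  · rw [← semimoduleMul_mapDomain, ← Finsupp.mapDomain_comp]
    congr 1
    exact Finsupp.mapDomain_congr fun q hq => (hw q hq).2.1
  · rw [← semimoduleMul_mapDomain, ← Finsupp.mapDomain_comp]
    congr 1
    exact Finsupp.mapDomain_congr fun q hq => (hw q hq).2.2

theorem coupled_semimoduleMul (hS : IsPositiveSemifield S) {X Y : Type u} (R : X → Y → Prop)
    (Θ : (X →₀ S) →₀ S) (χ : Y →₀ S) :
    Coupled R (semimoduleMul S X Θ) χ ↔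
      ∃ Ξ, Coupled (Coupled R) Θ Ξ ∧ semimoduleMul S Y Ξ = χ := by
  constructor
  · rintro ⟨ψ, h, hΘ, rfl⟩
    obtain ⟨Θ', rfl, rfl⟩ := hS.exists_semimoduleMul_eq Prod.fst ψ Θ hΘ.symm
    refine ⟨Θ'.mapDomain (Finsupp.mapDomain Prod.snd), .of_span _ _ _ fun ω hω => ?_,
      semimoduleMul_mapDomain S _ _⟩
    exact ⟨ω, fun p hp => h p (hS.support_subset_support_semimoduleMul Θ' hω hp), rfl, rfl⟩
  · rintro ⟨Ξ, h, rfl⟩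
    exact h.semimoduleMul

theorem mem_canonicalLaw {X : Type u} (Φ : Set X →₀ S) (φ : X →₀ S) :
    φ ∈ canonicalLaw Φ ↔ Coupled (fun (A : Set X) x => x ∈ A) Φ φ := by
  constructor
  · rintro ⟨ψ, rfl, rfl⟩
    exact .of_span _ _ _ fun p _ => p.2
  · rintro ⟨ψ, h, rfl, rfl⟩
    have := mapDomain_val_subtypeDomain (fun p : Set X × X => p.2 ∈ p.1) ψ h
    refine ⟨ψ.subtypeDomain fun p : Set X × X => p.2 ∈ p.1, ?_, ?_⟩
    · conv_lhs => rw [← this]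
      rw [← Finsupp.mapDomain_comp]; rfl
    · conv_lhs => rw [← this]
      rw [← Finsupp.mapDomain_comp]; rfl

end Couplings

/-! ### The two descriptions of the canonical law -/

section CanonicalLaw

variable {S : Type u} [Semiring S]

theorem sum_mapDomain {X Y : Type*} (f : X → Y) (φ : X →₀ S) :
    ((φ.mapDomain f).sum fun _ s => s) = φ.sum fun _ s => s :=
  Finsupp.sum_mapDomain_index (by simp) (by simp)

theorem mapDomain_const {X Y : Type*} (y : Y) (φ : X →₀ S) :
    φ.mapDomain (fun _ => y) = Finsupp.single y (φ.sum fun _ s => s) := by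
  rw [Finsupp.mapDomain, Finsupp.single_sum]

/-- This computes `δ ∘ η`. The result is generally larger than the set of all `Δ_x` with `x ∈ B`,
which is why the law is only weak; its image under an algebra is the convex closure. -/
theorem mem_canonicalLaw_single (hS : IsPositiveSemifield S) {X : Type u} (B : Set X)
    (φ : X →₀ S) : φ ∈ canonicalLaw (Finsupp.single B (1 : S)) ↔
      (φ.support : Set X) ⊆ B ∧ (φ.sum fun _ s => s) = 1 := by
  rw [mem_canonicalLaw]
  constructor
  · rintro ⟨ψ, h, hB, rfl⟩
    refine ⟨fun x hx => ?_, ?_⟩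
    · obtain ⟨p, hp, rfl⟩ := exists_mem_support_mapDomain hx
      have := hS.mapDomain_apply_ne_zero Prod.fst ψ (Finsupp.mem_support_iff.1 hp)
      rw [hB] at this
      have : p.1 = B := by
        by_contra hne
        exact this (Finsupp.single_eq_of_ne hne)
      exact this ▸ h p hp
    · rw [sum_mapDomain, ← sum_mapDomain Prod.fst, hB]
      simp
  · rintro ⟨h, h1⟩
    have := Coupled.of_span (R := fun (A : Set X) x => x ∈ A) φ (fun _ => B) id fun x hx => h hx
    rwa [mapDomain_const, h1, Finsupp.mapDomain_id] at this

theorem image_canonicalLaw_single (hS : IsPositiveSemifield S) {X : Type u} (a : (X →₀ S) → X)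
    (B : Set X) : a '' canonicalLaw (Finsupp.single B (1 : S)) = convexClosure a B := by
  ext x
  simp only [Set.mem_image, mem_canonicalLaw_single hS, convexClosure, Set.mem_ofPred_eq, and_assoc]

/-- The part of `ψ : X × Y →₀ S` over `x`, as an element of `Y →₀ S`. -/
noncomputable def slice {X Y : Type*} (ψ : X × Y →₀ S) (x : X) : Y →₀ S :=
  open Classical in (ψ.filter fun p => p.1 = x).mapDomain Prod.snd

theorem mem_support_of_mem_support_slice {X Y : Type*} {ψ : X × Y →₀ S} {x : X} {y : Y}
    (h : y ∈ (slice ψ x).support) : (x, y) ∈ ψ.support := by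
  classical
  obtain ⟨⟨x', y⟩, hp, rfl⟩ := exists_mem_support_mapDomain h
  rw [Finsupp.support_filter, Finset.mem_filter] at hp
  obtain ⟨hp, rfl⟩ := hp
  exact hp

theorem sum_slice {X Y : Type*} (ψ : X × Y →₀ S) (x : X) :
    ((slice ψ x).sum fun _ s => s) = ψ.mapDomain Prod.fst x := by
  classical
  rw [slice, sum_mapDomain, mapDomain_apply_eq_sum, Finsupp.sum_filter_index, Finsupp.sum,
    Finsupp.support_filter, Finset.sum_filter]

/-- By positivity the support of the first marginal misses no nonzero slice. -/
theorem sum_slices (hS : IsPositiveSemifield S) {X Y : Type*} (ψ : X × Y →₀ S) :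
    ∑ x ∈ (ψ.mapDomain Prod.fst).support, slice ψ x = ψ.mapDomain Prod.snd := by
  classical
  simp only [slice]
  rw [← Finsupp.mapDomain_finsetSum]
  congr 1
  ext p
  rw [Finsupp.finsetSum_apply]
  simp only [Finsupp.filter_apply]
  rw [Finset.sum_ite_eq]
  by_cases hp : ψ p = 0
  · simp [hp]
  · rw [if_pos]
    exact Finsupp.mem_support_iff.2 (hS.mapDomain_apply_ne_zero _ _ hp)

/-- Every finite family of elements of `X →₀ S` of total mass one has a joint distribution. -/
theorem IsPositiveSemifield.exists_joint (hS : IsPositiveSemifield S) {I X : Type*}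
    (A : I → Set X) (q : I → X →₀ S) (hq : ∀ i, ((q i).sum fun _ s => s) = 1)
    (hA : ∀ i, ((q i).support : Set X) ⊆ A i) (u₀ : I → X) (hu₀ : ∀ i, u₀ i ∈ A i)
    (s : Finset I) : ∃ l : (I → X) →₀ S, (l.sum fun _ r => r) = 1 ∧
      (∀ u ∈ l.support, ∀ i, u i ∈ A i) ∧ ∀ i ∈ s, l.mapDomain (fun u => u i) = q i := by
  classical
  induction s using Finset.induction_on with
  | empty =>
    -- The selection `u₀` keeps the coordinates not yet treated inside their sets.
    refine ⟨Finsupp.single u₀ 1, by simp, fun u hu => ?_, by simp⟩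
    rwa [Finset.mem_singleton.1 (Finsupp.support_single_subset hu)]
  | insert j s hj ih =>
    obtain ⟨l, h1, hl, hm⟩ := ih
    -- Both distributions have mass one, so they couple over a point; the new value then overwrites
    -- coordinate `j`.
    obtain ⟨ω, hω, rfl, hω'⟩ := hS.exists_coupling (fun _ => ()) (fun _ => ()) l (q j)
      (by rw [mapDomain_const, mapDomain_const, h1, hq])
    refine ⟨ω.mapDomain fun p => Function.update p.1 j p.2, ?_, fun u hu i => ?_, fun i hi => ?_⟩
    · rwa [sum_mapDomain, ← sum_mapDomain Prod.fst]
    · obtain ⟨p, hp, rfl⟩ := exists_mem_support_mapDomain hu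
      by_cases hij : i = j
      · subst hij
        rw [Function.update_self]
        exact hA i (hω p hp).2.1
      · rw [Function.update_of_ne hij]
        exact hl _ (hω p hp).1 i
    · rw [← Finsupp.mapDomain_comp]
      by_cases hij : i = j
      · subst hij
        rw [← hω']
        congr 1
        ext p
        simp
      · rw [← hm i (Finset.mem_of_mem_insert_of_ne hi hij), ← Finsupp.mapDomain_comp]
        congr 1
        ext p
        simp [hij]

theorem coupled_of_mem_choice {X : Type u} {Φ : Set X →₀ S} {φ : X →₀ S} (h : φ ∈ choice Φ) :
    Coupled (fun (A : Set X) x => x ∈ A) Φ φ := by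
  obtain ⟨u, hu, rfl⟩ := h
  have := Coupled.of_span (R := fun (A : Set X) x => x ∈ A)
    (Φ.subtypeDomain (· ∈ Φ.support)) Subtype.val u fun A _ => hu A
  rwa [mapDomain_val_subtypeDomain _ _ fun _ h => h] at this

/-- A mixture of choices depends on `l` only through its coordinate marginals. The weights of `l`
multiply on the left, so `Φ A` ends up acting on the right. -/
theorem semimoduleMul_mapDomain_choice {X : Type u} (Φ : Set X →₀ S)
    (l : ({A : Set X // A ∈ Φ.support} → X) →₀ S) :
    semimoduleMul S X (l.mapDomain fun u =>
        (Φ.subtypeDomain (· ∈ Φ.support)).mapDomain u) =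
      ∑ A : {A : Set X // A ∈ Φ.support}, MulOpposite.op (Φ A) • l.mapDomain fun u => u A := by
  induction l using Finsupp.induction_linear with
  | zero => simp [semimoduleMul_zero]
  | add f g hf hg =>
    simp [Finsupp.mapDomain_add, semimoduleMul_add, hf, hg, Finset.sum_add_distrib]
  | single u r =>
    rw [Finsupp.mapDomain_single, semimoduleMul_single, Finsupp.mapDomain, Finsupp.sum_fintype]
    · simp [Finset.smul_sum, Finsupp.mapDomain_single, -Finsupp.single_mul]
    · simp

/-- The two descriptions of the canonical law agree. -/
theorem canonicalLaw_eq_convexClosure (hS : IsPositiveSemifield S) {X : Type u}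
    (Φ : Set X →₀ S) :
    canonicalLaw Φ = convexClosure (semimoduleMul S X) (choice Φ) := by
  classical
  ext φ
  rw [mem_canonicalLaw]
  constructor
  · rintro ⟨ψ, hψ, rfl, rfl⟩
    choose! inv hinv using hS.exists_inv
    set Φ := ψ.mapDomain Prod.fst with hΦ
    -- The slices are normalised on the right, because `Φ A` will multiply the marginals of `l` from
    -- the right.
    let q : {A : Set X // A ∈ Φ.support} → X →₀ S := fun A =>
      MulOpposite.op (inv (Φ A)) • slice ψ A.1
    have hqA : ∀ A, ((q A).support : Set X) ⊆ A.1 := fun A x hx =>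
      hψ _ (mem_support_of_mem_support_slice (Finsupp.support_smul hx))
    have hu : ∀ A : {A : Set X // A ∈ Φ.support}, ∃ x, x ∈ A.1 := by
      rintro ⟨A, hA⟩
      obtain ⟨p, hp, rfl⟩ := exists_mem_support_mapDomain hA
      exact ⟨p.2, hψ p hp⟩
    choose u₀ hu₀ using hu
    obtain ⟨l, h1, hl, hlq⟩ := hS.exists_joint (fun A => A.1) q
      (fun A => by
        have : ((q A).sum fun _ s => s) = (slice ψ A.1).sum fun _ s => s * inv (Φ A) :=
          Finsupp.sum_smul_index' (by simp)
        rw [this, ← Finsupp.sum_mul, sum_slice]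
        exact (hinv _ (Finsupp.mem_support_iff.1 A.2)).1) hqA u₀ hu₀ Finset.univ
    refine ⟨l.mapDomain fun u => (Φ.subtypeDomain (· ∈ Φ.support)).mapDomain u, ?_, ?_, ?_⟩
    · intro χ hχ
      obtain ⟨u, hu, rfl⟩ := exists_mem_support_mapDomain hχ
      exact ⟨u, hl u hu, rfl⟩
    · rw [sum_mapDomain, h1]
    · rw [semimoduleMul_mapDomain_choice, ← sum_slices hS ψ, ← hΦ,
        ← Finset.sum_coe_sort Φ.support (slice ψ)]
      refine Finset.sum_congr rfl fun A _ => ?_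
      rw [hlq A (Finset.mem_univ _)]
      ext x
      simp only [q, Finsupp.smul_apply, op_smul_eq_mul, mul_assoc]
      rw [(hinv _ (Finsupp.mem_support_iff.1 A.2)).2, mul_one]
  · rintro ⟨Ψ, hΨ, h1, rfl⟩
    -- Each component of `Ψ` is coupled with `Φ`, and total mass one makes the constant push-forward
    -- equal to `Δ_Φ`, whose mixture is `Φ` itself.
    have : Coupled (Coupled fun (A : Set X) x => x ∈ A) (Finsupp.single Φ (1 : S)) Ψ := by
      rw [← h1, ← mapDomain_const]
      conv_rhs => rw [← Finsupp.mapDomain_id (v := Ψ)]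
      exact .of_span _ _ _ fun φ hφ => coupled_of_mem_choice (hΨ hφ)
    simpa [semimoduleMul_single] using this.semimoduleMul

theorem alpha_eq_image_canonicalLaw (hS : IsPositiveSemifield S) {X : Type u}
    (a : (X →₀ S) → X) (ha : ∀ Ψ, a (semimoduleMul S X Ψ) = a (Ψ.mapDomain a))
    (Ω : ConvexSubset a →₀ S) :
    alpha a Ω = a '' canonicalLaw (Ω.mapDomain Subtype.val) := by
  classical
  apply Set.Subset.antisymm
  · exact Set.image_mono fun φ hφ => (mem_canonicalLaw _ _).2 (coupled_of_mem_choice hφ)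
  · rintro _ ⟨φ, hφ, rfl⟩
    rw [mem_canonicalLaw] at hφ
    obtain ⟨ψ, hψ, hΦ, rfl⟩ := hφ
    choose! inv hinv using hS.exists_inv
    rw [alpha, ← hΦ]
    have hconv : ∀ A ∈ (ψ.mapDomain Prod.fst).support, A = convexClosure a A := by
      intro A hA
      rw [hΦ] at hA
      obtain ⟨B, -, rfl⟩ := exists_mem_support_mapDomain hA
      exact B.2
    set Φ := ψ.mapDomain Prod.fst
    -- Here the normalisation is on the left, since mixing the `p A` with weights `Φ A` multiplies
    -- on the left. By convexity `a (p A)` lies in `A`, so it serves as the chosen point.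
    let p : Set X → X →₀ S := fun A => inv (Φ A) • slice ψ A
    refine ⟨(Φ.subtypeDomain (· ∈ Φ.support)).mapDomain fun A => a (p A.1),
      ⟨_, fun A => ?_, rfl⟩, ?_⟩
    · refine (hconv A.1 A.2).symm.subset ?_
      refine ⟨p A.1, fun x hx =>
        hψ _ (mem_support_of_mem_support_slice (Finsupp.support_smul hx)), ?_, rfl⟩
      have : ((p A.1).sum fun _ s => s) = (slice ψ A.1).sum fun _ s => inv (Φ A) * s :=
        Finsupp.sum_smul_index' (by simp)
      rw [this, ← Finsupp.mul_sum, sum_slice]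
      exact (hinv _ (Finsupp.mem_support_iff.1 A.2)).2
    · have : semimoduleMul S X (Φ.mapDomain p) = ψ.mapDomain Prod.snd := by
        rw [semimoduleMul, Finsupp.sum_mapDomain_index (by simp) (by simp [add_smul]),
          ← sum_slices hS ψ]
        refine Finset.sum_congr rfl fun A hA => ?_
        simp only [p]
        rw [smul_smul, (hinv _ (Finsupp.mem_support_iff.1 hA)).1, one_smul]
      rw [← this, ha, ← Finsupp.mapDomain_comp]
      conv_rhs => rw [← mapDomain_val_subtypeDomain (· ∈ Φ.support) Φ fun _ h => h,
        ← Finsupp.mapDomain_comp]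
      rfl

end CanonicalLaw

/-! ### Weak liftings determined by a weak distributive law -/

section Lifting

variable {C : Type u} [Category.{v} C] {T R : Monad C} (δ : WeakDistributiveLaw T R)

namespace WeakDistributiveLaw

theorem law_naturality {X Y : C} (f : X ⟶ Y) :
    T.map (R.map f) ≫ δ.law.app Y = δ.law.app X ≫ R.map (T.map f) :=
  δ.law.naturality f

/-- The semialgebra structure `T R X → R X` on a `T`-algebra `X`. -/
def act (A : T.Algebra) : T.obj (R.obj A.A) ⟶ R.obj A.A :=
  δ.law.app A.A ≫ R.map A.a

/-- The idempotent on `R X` whose splitting is the lifting of `R` at the `T`-algebra `X`. -/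
def idem (A : T.Algebra) : R.obj A.A ⟶ R.obj A.A :=
  T.η.app (R.obj A.A) ≫ δ.act A

/-- Associativity needs only `mul_inner`; the missing axiom would have given the unit law. -/
theorem map_act_act (A : T.Algebra) :
    T.map (δ.act A) ≫ δ.act A = T.μ.app (R.obj A.A) ≫ δ.act A := by
  simp only [act, Functor.map_comp, Category.assoc]
  rw [reassoc_of% law_naturality, ← R.map_comp, ← A.assoc, R.map_comp, reassoc_of% mul_inner]

theorem map_idem_act (A : T.Algebra) : T.map (δ.idem A) ≫ δ.act A = δ.act A := by
  rw [idem, T.map_comp, Category.assoc, map_act_act, T.right_unit_assoc]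

theorem act_idem (A : T.Algebra) : δ.act A ≫ δ.idem A = δ.act A := by
  have := T.η.naturality (δ.act A)
  dsimp at this
  rw [idem, reassoc_of% this, map_act_act, T.left_unit_assoc]

theorem idem_idem (A : T.Algebra) : δ.idem A ≫ δ.idem A = δ.idem A := by
  conv_lhs => enter [1]; rw [idem]
  rw [Category.assoc, act_idem, idem]

theorem act_map {A B : T.Algebra} (f : A ⟶ B) :
    T.map (R.map f.f) ≫ δ.act B = δ.act A ≫ R.map f.f := by
  rw [act, reassoc_of% law_naturality, ← R.map_comp, f.h, R.map_comp, act, Category.assoc]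

theorem idem_map {A B : T.Algebra} (f : A ⟶ B) :
    R.map f.f ≫ δ.idem B = δ.idem A ≫ R.map f.f := by
  have := T.η.naturality (R.map f.f)
  dsimp at this
  rw [idem, reassoc_of% this, act_map, idem, Category.assoc]

theorem map_unit_act (A : T.Algebra) :
    T.map (R.η.app A.A) ≫ δ.act A = A.a ≫ R.η.app A.A := by
  have := (reassoc_of% (δ.unit_outer A.A)) (R.map A.a)
  rw [act]
  exact this.trans (R.η.naturality A.a).symm

theorem unit_idem (A : T.Algebra) : R.η.app A.A ≫ δ.idem A = R.η.app A.A := by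
  have := T.η.naturality (R.η.app A.A)
  dsimp at this
  rw [idem, reassoc_of% this, map_unit_act, ← Category.assoc, A.unit, Category.id_comp]

theorem map_mul_act (A : T.Algebra) :
    T.map (R.μ.app A.A) ≫ δ.act A =
      δ.law.app (R.obj A.A) ≫ R.map (δ.act A) ≫ R.μ.app A.A := by
  rw [act, ← reassoc_of% mul_outer, R.map_comp, Category.assoc]
  have := R.μ.naturality A.a
  dsimp at this
  rw [this]

/-- Once `mul_outer` has moved the outer idempotent past `μ`, the action sits under `R` and absorbs
the inner idempotent. This gives the compatibility of `π` with multiplication. -/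
theorem map_idem_mul_idem (A : T.Algebra) :
    R.map (δ.idem A) ≫ R.μ.app A.A ≫ δ.idem A = R.μ.app A.A ≫ δ.idem A := by
  have h : R.μ.app A.A ≫ δ.idem A =
      T.η.app _ ≫ δ.law.app (R.obj A.A) ≫ R.map (δ.act A) ≫ R.μ.app A.A := by
    have := T.η.naturality (R.μ.app A.A)
    dsimp at this
    rw [idem, reassoc_of% this, map_mul_act]
  have h' := T.η.naturality (R.map (δ.idem A))
  dsimp at h'
  rw [h, reassoc_of% h', reassoc_of% law_naturality, ← R.map_comp_assoc, map_idem_act]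

/-- The algebra structure on a splitting of the idempotent `δ.idem A`. -/
def splitAlgebra (A : T.Algebra) {K : C} (ι : K ⟶ R.obj A.A) (π : R.obj A.A ⟶ K)
    (ι_π : ι ≫ π = 𝟙 K) (π_ι : π ≫ ι = δ.idem A) : T.Algebra where
  A := K
  a := T.map ι ≫ δ.act A ≫ π
  unit := by
    have h := T.η.naturality ι
    dsimp at h
    rw [← reassoc_of% h, ← Category.assoc (T.η.app _)]
    change ι ≫ δ.idem A ≫ π = _
    rw [← π_ι, Category.assoc, ι_π, Category.comp_id, ι_π]
  assoc := by
    have h := T.μ.naturality ι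
    dsimp at h
    rw [← reassoc_of% h, ← reassoc_of% map_act_act]
    simp only [Functor.map_comp, Category.assoc]
    rw [← T.map_comp_assoc π, π_ι, reassoc_of% map_idem_act]

theorem comp_eq_map_act {A : T.Algebra} {K : C} {ι : K ⟶ R.obj A.A} {π : R.obj A.A ⟶ K}
    (π_ι : π ≫ ι = δ.idem A) {a : T.obj K ⟶ K} (ha : a = T.map ι ≫ δ.act A ≫ π) :
    a ≫ ι = T.map ι ≫ δ.act A := by
  rw [ha, Category.assoc, Category.assoc, π_ι, act_idem]

/-- A choice of splittings of the idempotents `δ.idem A`, with the induced algebra structures. -/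
structure Splitting where
  obj : T.Algebra → T.Algebra
  ι : ∀ A, (obj A).A ⟶ R.obj A.A
  π : ∀ A, R.obj A.A ⟶ (obj A).A
  ι_π : ∀ A, ι A ≫ π A = 𝟙 (obj A).A
  π_ι : ∀ A, π A ≫ ι A = δ.idem A
  a_ι : ∀ A, (obj A).a ≫ ι A = T.map (ι A) ≫ δ.act A

namespace Splitting

variable {δ}

/-- The splittings given by objects of the base category. -/
def ofSplit (K : T.Algebra → C) (ι : ∀ A, K A ⟶ R.obj A.A) (π : ∀ A, R.obj A.A ⟶ K A)
    (ι_π : ∀ A, ι A ≫ π A = 𝟙 (K A)) (π_ι : ∀ A, π A ≫ ι A = δ.idem A) : δ.Splitting where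
  obj A := δ.splitAlgebra A (ι A) (π A) (ι_π A) (π_ι A)
  ι := ι
  π := π
  ι_π := ι_π
  π_ι := π_ι
  a_ι A := δ.comp_eq_map_act (π_ι A) rfl

variable (K : δ.Splitting)

theorem ι_idem (A : T.Algebra) : K.ι A ≫ δ.idem A = K.ι A := by
  rw [← K.π_ι, reassoc_of% K.ι_π]

/-- As `ι` is a split monomorphism, all laws of the lifted monad can be tested inside `R X`. -/
theorem hom_ext {A : T.Algebra} {X : C} {f g : X ⟶ (K.obj A).A} (h : f ≫ K.ι A = g ≫ K.ι A) :
    f = g := by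
  rw [← Category.comp_id f, ← K.ι_π, reassoc_of% h, K.ι_π, Category.comp_id]

/-- A map into `R X` that factors through the splitting, as a morphism of algebras. -/
def lift {A B : T.Algebra} (f : B.A ⟶ R.obj A.A) (hf : f ≫ δ.idem A = f)
    (hh : T.map f ≫ δ.act A = B.a ≫ f) : B ⟶ K.obj A where
  f := f ≫ K.π A
  h := by
    apply K.hom_ext
    simp only [Category.assoc, K.a_ι, K.π_ι, hf, ← T.map_comp_assoc, hh]

theorem lift_ι {A B : T.Algebra} (f : B.A ⟶ R.obj A.A) (hf : f ≫ δ.idem A = f)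
    (hh : T.map f ≫ δ.act A = B.a ≫ f) : (K.lift f hf hh).f ≫ K.ι A = f := by
  rw [lift, Category.assoc, K.π_ι, hf]

/-- The action of the lifted functor on morphisms. -/
def map {A B : T.Algebra} (f : A ⟶ B) : K.obj A ⟶ K.obj B :=
  K.lift (K.ι A ≫ R.map f.f)
    (by rw [Category.assoc, idem_map, reassoc_of% K.ι_idem])
    (by rw [T.map_comp, Category.assoc, act_map, reassoc_of% K.a_ι])

theorem map_ι {A B : T.Algebra} (f : A ⟶ B) : (K.map f).f ≫ K.ι B = K.ι A ≫ R.map f.f :=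
  K.lift_ι _ _ _

/-- The inclusion followed by the multiplication of `R`. -/
def join (A : T.Algebra) : R.obj (K.obj A).A ⟶ R.obj A.A :=
  R.map (K.ι A) ≫ R.μ.app A.A

theorem map_join_act (A : T.Algebra) :
    T.map (K.join A) ≫ δ.act A = δ.act (K.obj A) ≫ K.join A := by
  rw [join, T.map_comp, Category.assoc, map_mul_act, reassoc_of% law_naturality,
    ← R.map_comp_assoc, ← K.a_ι, R.map_comp_assoc, act, Category.assoc]

/-- Maps compatible with the semialgebra actions commute with the idempotents. -/
theorem idem_join (A : T.Algebra) :
    δ.idem (K.obj A) ≫ K.join A = K.join A ≫ δ.idem A := by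
  have := T.η.naturality (K.join A)
  dsimp at this
  rw [idem, Category.assoc, ← map_join_act, idem, reassoc_of% this]

/-- The unit of the lifted monad. -/
def unit (A : T.Algebra) : A ⟶ K.obj A :=
  K.lift (R.η.app A.A) (δ.unit_idem A) (δ.map_unit_act A)

theorem unit_ι (A : T.Algebra) : (K.unit A).f ≫ K.ι A = R.η.app A.A :=
  K.lift_ι _ _ _

/-- The multiplication of the lifted monad. -/
def mul (A : T.Algebra) : K.obj (K.obj A) ⟶ K.obj A :=
  K.lift (K.ι (K.obj A) ≫ K.join A)
    (by rw [Category.assoc, ← idem_join, reassoc_of% K.ι_idem])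
    (by rw [T.map_comp, Category.assoc, map_join_act, reassoc_of% K.a_ι])

theorem mul_ι (A : T.Algebra) :
    (K.mul A).f ≫ K.ι A = K.ι (K.obj A) ≫ R.map (K.ι A) ≫ R.μ.app A.A :=
  K.lift_ι _ _ _

theorem π_map {A B : T.Algebra} (f : A ⟶ B) : R.map f.f ≫ K.π B = K.π A ≫ (K.map f).f := by
  apply K.hom_ext
  simp only [Category.assoc, map_ι, K.π_ι, reassoc_of% K.π_ι, idem_map]

theorem π_mul (A : T.Algebra) :
    R.map (K.π A) ≫ K.π (K.obj A) ≫ (K.mul A).f = R.μ.app A.A ≫ K.π A := by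
  apply K.hom_ext
  simp only [Category.assoc, mul_ι, K.π_ι, reassoc_of% K.π_ι]
  change R.map (K.π A) ≫ δ.idem (K.obj A) ≫ K.join A = _
  rw [idem_join, join, Category.assoc, ← R.map_comp_assoc, K.π_ι, map_idem_mul_idem]

theorem a_eq (A : T.Algebra) :
    (K.obj A).a = T.map (K.ι A) ≫ δ.law.app A.A ≫ R.map A.a ≫ K.π A := by
  apply K.hom_ext
  have := K.a_ι A
  rw [← act_idem, act, Category.assoc] at this
  rw [this]
  simp only [Category.assoc, K.π_ι]

/-- The lifted monad. -/
@[reducible]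
def monad : Monad T.Algebra where
  obj := K.obj
  map := K.map
  map_id A := by
    ext
    apply K.hom_ext
    simp [map_ι]
  map_comp f g := by
    ext
    apply K.hom_ext
    simp [map_ι, reassoc_of% map_ι]
  η :=
    { app := K.unit
      naturality := fun A B f => by
        ext
        apply K.hom_ext
        have := R.η.naturality f.f
        dsimp at this
        simp [map_ι, unit_ι, reassoc_of% unit_ι, this] }
  μ :=
    { app := K.mul
      naturality := fun A B f => by
        ext
        apply K.hom_ext
        have := R.μ.naturality f.f
        dsimp at this
        simp only [Functor.comp_map, Monad.Algebra.comp_f, Category.assoc, map_ι, mul_ι,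
          reassoc_of% mul_ι, reassoc_of% map_ι, ← this, ← R.map_comp_assoc] }
  assoc A := by
    ext
    apply K.hom_ext
    have := R.μ.naturality (K.ι A)
    dsimp at this
    simp only [Monad.Algebra.comp_f, Category.assoc, mul_ι,
          reassoc_of% mul_ι, reassoc_of% map_ι, ← reassoc_of% this, ← R.map_comp_assoc]
    simp [R.assoc]
  left_unit A := by
    ext
    apply K.hom_ext
    have := R.η.naturality (K.ι A)
    dsimp at this
    simp [mul_ι, reassoc_of% unit_ι, ← reassoc_of% this]
  right_unit A := by
    ext
    apply K.hom_ext
    simp only [Monad.Algebra.comp_f, Category.assoc, mul_ι, reassoc_of% map_ι, ← R.map_comp_assoc,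
      unit_ι]
    simp

/-- The weak lifting of a choice of splittings. -/
def weakLifting : WeakLifting T R where
  monad := K.monad
  ι := { app := K.ι, naturality := fun _ _ f => K.map_ι f }
  π :=
    { app := K.π
      naturality := fun _ _ f => K.π_map f }
  ι_π := K.ι_π
  ι_mul _ := (K.mul_ι _).symm
  ι_unit := K.unit_ι
  π_mul := K.π_mul
  π_unit _ := rfl

theorem weakLifting_isDeterminedBy : K.weakLifting.IsDeterminedBy δ := fun A =>
  ⟨K.π_ι A, K.a_eq A⟩

end Splitting

end WeakDistributiveLaw

/-! ### Comparison of the composite monads -/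

/-- A presentation of an endofunctor as the splitting of the idempotents on `R (T X)` that belong
to the free algebras. -/
structure Presentation (F : C ⥤ C) where
  j : ∀ X, F.obj X ⟶ R.obj (T.obj X)
  p : ∀ X, R.obj (T.obj X) ⟶ F.obj X
  j_p : ∀ X, j X ≫ p X = 𝟙 (F.obj X)
  p_j : ∀ X, p X ≫ j X =
    T.η.app (R.obj (T.obj X)) ≫ δ.law.app (T.obj X) ≫ R.map (T.μ.app X)
  map_j : ∀ {X Y : C} (f : X ⟶ Y), F.map f ≫ j Y = j X ≫ R.map (T.map f)

namespace Presentation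

variable {δ} {F G : C ⥤ C} (P : Presentation δ F) (Q : Presentation δ G)

theorem hom_ext {X Y : C} {f g : Y ⟶ F.obj X} (h : f ≫ P.j X = g ≫ P.j X) : f = g := by
  rw [← Category.comp_id f, ← P.j_p, reassoc_of% h, P.j_p, Category.comp_id]

/-- Both presentations split the same idempotent, which depends on `δ` alone. -/
theorem j_p_j (X : C) : P.j X ≫ Q.p X ≫ Q.j X = P.j X := by
  rw [Q.p_j, ← P.p_j, reassoc_of% P.j_p]

/-- Two functors with presentations are isomorphic. -/
@[simps!]
def iso : F ≅ G :=
  NatIso.ofComponents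
    (fun X =>
      { hom := P.j X ≫ Q.p X
        inv := Q.j X ≫ P.p X
        hom_inv_id := P.hom_ext (by simp only [Category.assoc, j_p_j, Category.id_comp])
        inv_hom_id := Q.hom_ext (by simp only [Category.assoc, j_p_j, Category.id_comp]) })
    (fun f => Q.hom_ext (by simp only [Category.assoc, j_p_j, map_j, reassoc_of% j_p_j]))

theorem iso_hom_j (X : C) : (P.iso Q).hom.app X ≫ Q.j X = P.j X := by
  rw [iso_hom_app, Category.assoc, j_p_j]

theorem iso_inv_j (X : C) : (P.iso Q).inv.app X ≫ P.j X = Q.j X := by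
  rw [iso_inv_app, Category.assoc, j_p_j]

/-- Compatibility of a presentation with monad structures. -/
structure IsMonadic {N : Monad C} (P : Presentation δ N.toFunctor) : Prop where
  η_j : ∀ X, N.η.app X ≫ P.j X = T.η.app X ≫ R.η.app (T.obj X)
  μ_j : ∀ X, N.μ.app X ≫ P.j X =
    P.j (N.obj X) ≫ R.map (T.map (P.j X) ≫ δ.law.app (T.obj X) ≫ R.map (T.μ.app X)) ≫
      R.μ.app (T.obj X)

/-- Monads with compatible presentations are isomorphic. -/
theorem IsMonadic.exists_iso {N N' : Monad C} {P : Presentation δ N.toFunctor}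
    {Q : Presentation δ N'.toFunctor} (hP : P.IsMonadic) (hQ : Q.IsMonadic) :
    ∃ e : N ≅ N', ∀ X, e.hom.app X ≫ Q.j X = P.j X := by
  refine ⟨MonadIso.mk (P.iso Q) (fun X => Q.hom_ext ?_) (fun X => Q.hom_ext ?_), P.iso_hom_j Q⟩
  · rw [Category.assoc, iso_hom_j, hP.η_j, hQ.η_j]
  · simp only [Category.assoc]
    rw [iso_hom_j, hP.μ_j, hQ.μ_j, reassoc_of% iso_hom_j, reassoc_of% map_j, ← R.map_comp_assoc,
      ← T.map_comp_assoc, iso_hom_j]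

/-- A monad structure can be transported to every functor with a presentation. -/
theorem IsMonadic.exists_monadStructure {N : Monad C} {P : Presentation δ N.toFunctor}
    (hP : P.IsMonadic) (Q : Presentation δ G) :
    ∃ M : MonadStructure G, IsMonadic (N := M.toMonad) Q := by
  let N' := N.transport (P.iso Q)
  refine ⟨⟨N'.η, N'.μ, N'.assoc, N'.left_unit, N'.right_unit⟩, fun X => ?_, fun X => ?_⟩
  · change (N.η.app X ≫ (P.iso Q).hom.app X) ≫ Q.j X = _
    rw [Category.assoc, iso_hom_j, hP.η_j]
  · change (((P.iso Q).inv.app (G.obj X) ≫ N.map ((P.iso Q).inv.app X)) ≫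
      N.μ.app X ≫ (P.iso Q).hom.app X) ≫ Q.j X = Q.j (G.obj X) ≫ _
    simp only [Category.assoc]
    rw [iso_hom_j, hP.μ_j, reassoc_of% map_j, reassoc_of% iso_inv_j, ← R.map_comp_assoc,
      ← T.map_comp_assoc, iso_inv_j]
    rfl

end Presentation

namespace WeakLifting

open WeakDistributiveLaw

variable {δ} {W : WeakLifting T R}

/-- The splittings of a weak lifting that is determined by `δ`. -/
def IsDeterminedBy.splitting (hW : W.IsDeterminedBy δ) : δ.Splitting where
  obj A := W.monad.obj A
  ι A := W.ι.app A
  π A := W.π.app A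
  ι_π A := W.ι_π A
  π_ι A := (hW A).1
  a_ι A := δ.comp_eq_map_act (hW A).1 ((hW A).2.trans
    (congrArg (T.map (W.ι.app A) ≫ ·) (Category.assoc _ _ _).symm))

theorem IsDeterminedBy.map_ι (hW : W.IsDeterminedBy δ) {A B : T.Algebra} (f : A ⟶ B) :
    (W.monad.map f).f ≫ hW.splitting.ι B = hW.splitting.ι A ≫ R.map f.f :=
  W.ι.naturality f

theorem IsDeterminedBy.unit_ι (hW : W.IsDeterminedBy δ) (A : T.Algebra) :
    (W.monad.η.app A).f ≫ hW.splitting.ι A = R.η.app A.A :=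
  W.ι_unit A

theorem IsDeterminedBy.mul_ι (hW : W.IsDeterminedBy δ) (A : T.Algebra) :
    (W.monad.μ.app A).f ≫ hW.splitting.ι A =
      hW.splitting.ι (hW.splitting.obj A) ≫ R.map (hW.splitting.ι A) ≫ R.μ.app A.A :=
  (W.ι_mul A).symm

/-- The structure map of an algebra, as a morphism out of the free algebra. -/
def structureMap (A : T.Algebra) : T.free.obj A.A ⟶ A where
  f := A.a
  h := A.assoc.symm

theorem compositeMonad_η_app (X : C) :
    W.compositeMonad.η.app X = T.η.app X ≫ (W.monad.η.app (T.free.obj X)).f := by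
  simp [compositeMonad]
  rfl

/-- The counit of the free-forgetful adjunction of `T` at the lifted algebra is its structure map.
-/
theorem compositeMonad_μ_app (X : C) :
    W.compositeMonad.μ.app X =
      (W.monad.map (structureMap (W.monad.obj (T.free.obj X)))).f ≫
        (W.monad.μ.app (T.free.obj X)).f := by
  simp [compositeMonad]
  rfl

/-- The presentation of the composite monad of a weak lifting determined by `δ`. -/
def IsDeterminedBy.presentation (hW : W.IsDeterminedBy δ) :
    Presentation δ W.compositeMonad.toFunctor where
  j X := W.ι.app (T.free.obj X)
  p X := W.π.app (T.free.obj X)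
  j_p _ := W.ι_π _
  p_j X := (hW (T.free.obj X)).1
  map_j f := hW.map_ι (T.free.map f)

theorem IsDeterminedBy.isMonadic (hW : W.IsDeterminedBy δ) : hW.presentation.IsMonadic where
  η_j X := by
    rw [compositeMonad_η_app]
    exact (Category.assoc _ _ _).trans
      (congrArg (T.η.app X ≫ ·) (hW.unit_ι (T.free.obj X)))
  μ_j X := by
    rw [compositeMonad_μ_app]
    set A := T.free.obj X
    set K := hW.splitting
    change ((W.monad.map (structureMap (K.obj A))).f ≫ (W.monad.μ.app A).f) ≫ K.ι A =
      K.ι (T.free.obj (K.obj A).A) ≫ R.map (T.map (K.ι A) ≫ δ.act A) ≫ R.μ.app A.A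
    refine (Category.assoc _ _ _).trans ((congrArg (_ ≫ ·) (hW.mul_ι A)).trans ?_)
    refine (Category.assoc _ _ _).symm.trans
      ((congrArg (· ≫ R.map (K.ι A) ≫ R.μ.app A.A)
        (hW.map_ι (structureMap (K.obj A)))).trans ?_)
    change (K.ι (T.free.obj (K.obj A).A) ≫ R.map (K.obj A).a) ≫ R.map (K.ι A) ≫ R.μ.app A.A = _
    have key : ∀ {V X Y Z Z' : C} (f : V ⟶ R.obj X) (g : X ⟶ Y) (h : Y ⟶ Z) (m : R.obj Z ⟶ Z'),
        (f ≫ R.map g) ≫ R.map h ≫ m = f ≫ R.map (g ≫ h) ≫ m := by simp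
    -- Followed by `ι`, the lifted structure map becomes the semialgebra action, leaving a formula
    -- in the inclusions, `δ` and `R` only.
    exact (key _ _ _ _).trans (congrArg (fun k =>
      K.ι (T.free.obj (K.obj A).A) ≫ R.map k ≫ R.μ.app A.A) (K.a_ι A))

end WeakLifting

end Lifting

/-! ### The canonical weak distributive law and the explicit monad -/

section Explicit

variable {S : Type u} [Semiring S]

/-- Membership in `f '' A` is `∋` followed by the graph of `f`. -/
theorem image_canonicalLaw_mapDomain (hS : IsPositiveSemifield S) {X Y : Type u} (f : X → Y)
    (Φ : Set X →₀ S) : canonicalLaw (Φ.mapDomain (f '' ·)) =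
      Finsupp.mapDomain f '' canonicalLaw Φ := by
  ext φ
  simp only [mem_canonicalLaw, coupled_graph_comp _ _ _ _ hS, Set.mem_image]
  exact coupled_comp_graph f (fun (A : Set X) x => x ∈ A) Φ φ hS

/-- Membership in a union is `∋` composed with itself. -/
theorem canonicalLaw_mapDomain_sUnion (hS : IsPositiveSemifield S) {X : Type u}
    (Φ : Set (Set X) →₀ S) : canonicalLaw (Φ.mapDomain Set.sUnion) =
      ⋃₀ (canonicalLaw '' canonicalLaw Φ) := by
  ext φ
  simp only [mem_canonicalLaw, coupled_graph_comp _ _ _ _ hS, Set.mem_sUnion, Set.mem_image,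
    exists_exists_and_eq_and]
  exact coupled_comp hS (fun (U : Set (Set X)) A => A ∈ U) (fun (A : Set X) x => x ∈ A) Φ φ

theorem canonicalLaw_mapDomain_singleton (hS : IsPositiveSemifield S) {X : Type u}
    (φ : X →₀ S) : canonicalLaw (φ.mapDomain ({·} : X → Set X)) = {φ} := by
  ext χ
  simp only [mem_canonicalLaw, coupled_graph_comp _ _ _ _ hS, Set.mem_singleton_iff]
  simpa [eq_comm] using coupled_graph id φ χ

theorem canonicalLaw_semimoduleMul (hS : IsPositiveSemifield S) {X : Type u}
    (Θ : (Set X →₀ S) →₀ S) : canonicalLaw (semimoduleMul S _ Θ) =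
      semimoduleMul S X '' canonicalLaw (Θ.mapDomain canonicalLaw) := by
  ext φ
  simp only [mem_canonicalLaw, coupled_graph_comp _ _ _ _ hS, Set.mem_image]
  exact coupled_semimoduleMul hS _ Θ φ

variable (S) in
/-- The canonical weak distributive law of the powerset monad over the semimodule monad. -/
noncomputable def canonicalWeakDistributiveLaw (hS : IsPositiveSemifield S) :
    WeakDistributiveLaw (semimoduleMonad S) powersetMonad.{u} where
  law :=
    { app := fun X => ↾(canonicalLaw : (Set X →₀ S) → Set (X →₀ S))
      naturality := fun X Y f => by
        apply ConcreteCategory.hom_ext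
        exact image_canonicalLaw_mapDomain hS f }
  mul_outer X := by
    apply ConcreteCategory.hom_ext
    exact fun Φ => (canonicalLaw_mapDomain_sUnion hS Φ).symm
  mul_inner X := by
    apply ConcreteCategory.hom_ext
    exact fun Φ => (canonicalLaw_semimoduleMul hS Φ).symm
  unit_outer X := by
    apply ConcreteCategory.hom_ext
    exact fun φ => canonicalLaw_mapDomain_singleton hS φ

/-! ### Convex closure as the idempotent of the canonical law -/

theorem idem_apply (hS : IsPositiveSemifield S) (A : (semimoduleMonad S).Algebra) (B : Set A.A) :
    (canonicalWeakDistributiveLaw S hS).idem A B = convexClosure (S := S) A.a B :=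
  image_canonicalLaw_single hS A.a B

theorem convexClosure_convexClosure (hS : IsPositiveSemifield S)
    (A : (semimoduleMonad S).Algebra) (B : Set A.A) :
    convexClosure (S := S) A.a (convexClosure (S := S) A.a B) = convexClosure (S := S) A.a B := by
  rw [← idem_apply hS, ← idem_apply hS]
  exact ConcreteCategory.congr_hom ((canonicalWeakDistributiveLaw S hS).idem_idem A) B

/-- The splittings through the sets of convex subsets. -/
noncomputable def convexSplitting (hS : IsPositiveSemifield S) :
    (canonicalWeakDistributiveLaw S hS).Splitting :=
  .ofSplit (fun A => ConvexSubset (S := S) A.a) (fun A => ↾Subtype.val)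
    (fun A => ↾(fun B => ⟨convexClosure (S := S) A.a B, (convexClosure_convexClosure hS A B).symm⟩))
    (fun A => by
      apply ConcreteCategory.hom_ext
      exact fun B => Subtype.ext B.2.symm)
    (fun A => by
      apply ConcreteCategory.hom_ext
      exact fun B => (idem_apply hS A B).symm)

/-- The presentation of the functor of convex subsets of free semimodules. -/
noncomputable def convexPresentation (hS : IsPositiveSemifield S) :
    Presentation (canonicalWeakDistributiveLaw S hS) (convexPowerset S) where
  j _ := ↾Subtype.val
  p X := (convexSplitting hS).π ((semimoduleMonad S).free.obj X)
  j_p X := (convexSplitting hS).ι_π ((semimoduleMonad S).free.obj X)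
  p_j X := (convexSplitting hS).π_ι ((semimoduleMonad S).free.obj X)
  map_j _ := rfl

/-- The algebra law required of `μ` is the associativity of the semimodule monad. -/
theorem alpha_semimoduleMul (hS : IsPositiveSemifield S) {X : Type u}
    (Ω : ConvexSubset (semimoduleMul S X) →₀ S) :
    alpha (semimoduleMul S X) Ω = semimoduleMul S X '' canonicalLaw (Ω.mapDomain Subtype.val) :=
  alpha_eq_image_canonicalLaw hS _
    (fun Ψ => (ConcreteCategory.congr_hom ((semimoduleMonad S).assoc X) Ψ).symm) Ω

end Explicit

end CompositeMonad

theorem mainTheorem4 (S : Type u) [Semiring S] (hS : CompositeMonad.IsPositiveSemifield S) :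
    ∃ δ : CompositeMonad.WeakDistributiveLaw (CompositeMonad.semimoduleMonad S)
        CompositeMonad.powersetMonad.{u},
      -- `δ` is the canonical weak distributive law, given by either of its two descriptions
      (∀ (X : Type u) (Φ : Set X →₀ S),
        δ.law.app X Φ = CompositeMonad.canonicalLaw Φ) ∧
      (∀ (X : Type u) (Φ : Set X →₀ S),
        δ.law.app X Φ = CompositeMonad.convexClosure (CompositeMonad.semimoduleMul S X)
          (CompositeMonad.choice Φ)) ∧
      -- the explicit monad
      ∃ M : CompositeMonad.MonadStructure (CompositeMonad.convexPowerset S),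
        (∀ (X : Type u) (x : X),
          (M.η.app X x).1 = ({Finsupp.single x (1 : S)} : Set (X →₀ S))) ∧
        (∀ (X : Type u)
          (A : (CompositeMonad.convexPowerset S).obj ((CompositeMonad.convexPowerset S).obj X)),
          (M.μ.app X A).1 =
            ⋃ Ω ∈ A.1, CompositeMonad.alpha (CompositeMonad.semimoduleMul S X) Ω) ∧
        -- it is the composite monad that `δ` induces
        (∃ W : CompositeMonad.WeakLifting (CompositeMonad.semimoduleMonad S)
          CompositeMonad.powersetMonad.{u}, W.IsDeterminedBy δ) ∧
        ∀ W : CompositeMonad.WeakLifting (CompositeMonad.semimoduleMonad S)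
          CompositeMonad.powersetMonad.{u}, W.IsDeterminedBy δ →
          ∃ e : M.toMonad ≅ W.compositeMonad,
            ∀ (X : Type u) (A : (CompositeMonad.convexPowerset S).obj X),
              W.ι.app ((CompositeMonad.semimoduleMonad S).free.obj X) (e.hom.app X A) = A.1 := by
  have hW₀ := (CompositeMonad.convexSplitting hS).weakLifting_isDeterminedBy
  -- The explicit monad is transported from one composite monad; the inclusions `j` then determine
  -- its unit and multiplication.
  obtain ⟨M, hM⟩ := hW₀.isMonadic.exists_monadStructure (CompositeMonad.convexPresentation hS)
  refine ⟨CompositeMonad.canonicalWeakDistributiveLaw S hS, fun _ _ => rfl,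
    fun _ Φ => CompositeMonad.canonicalLaw_eq_convexClosure hS Φ, M,
    fun X x => ?_, fun X A => ?_, ⟨_, hW₀⟩, fun W hW => ?_⟩
  · exact ConcreteCategory.congr_hom (hM.η_j X) x
  -- The general multiplication formula is the union of the images of `canonicalLaw Ω` under `μ`;
  -- convexity allows `choice` to replace the law.
  · refine (ConcreteCategory.congr_hom (hM.μ_j X) A).trans (Eq.trans ?_
      (Set.iUnion₂_congr fun Ω _ => (CompositeMonad.alpha_semimoduleMul hS Ω).symm))
    exact Set.sUnion_image _ _
  · obtain ⟨e, he⟩ := hM.exists_iso hW.isMonadic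
    exact ⟨e, fun X A => ConcreteCategory.congr_hom (he X) A⟩
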